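/- Let $G$ be a metric group that is presented as the union $G=\bigcup_{i\in\omega}K_i$ of an increasing sequence of closed balls of $1$ of finite radii such that, for every $n$, $1\in K_n$, $K_n\cdot K_n\cup K_n^{-1}\subseteq K_{n+1}$, and the multiplication $K_n\times K_n\to K_{n+1}$ is uniformly continuous. Let $\mathcal F=(F_i)_{i\in\omega}$ be a family of continuity moduli, i.e. functions with $F_i(\varepsilon)>0$ for all $\varepsilon>0$. Consider a group $\Gamma$ (either $G$ or a subgroup $H\le G$) with its presentation $\Gamma=\bigcup_i (K_i\cap \Gamma)$. A strongly continuous unitary representation of $\Gamma$ on a complex Hilbert space $\mathbf H$ is called *$\mathcal F$-continuous* if for every $i$ the action $(K_i\cap\Gamma)\times B_i\to B_i$, where $B_i=\{v\in\mathbf H:\|v\|\le i\}$, has continuity modulus $F_i$ in each of its two arguments: if one argument is changed by a distance $<F_i(\varepsilon)$ and the other is kept fixed, then the value is changed by a distance $<\varepsilon$. A closed set $Q\subseteq \Gamma$ is an *$\mathcal F$-Kazhdan set* for $\Gamma$ if there is $\varepsilon>0$ such that every $\mathcal F$-continuous unitary representation of $\Gamma$ having a unit vector $v$ with $\sup_{x\in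 Q}\|xv-v\|<\varepsilon$ also has a non-zero $\Gamma$-invariant vector. $\Gamma$ has *property (T) for $\mathcal F$-continuous representations* if it has a compact $\mathcal F$-Kazhdan set. The *density character* of a space is the smallest cardinality of a dense subset. A subgroup $H\le G$ is *elementary (in continuous logic)* if $(\{K_n\cap H\}_n,\cdot,{}^{-1},1)$ is an elementary substructure of the many-sorted metric structure $(\{K_n\}_n,\cdot,{}^{-1},1)$ (with sorts $K_n$ and operations $\cdot:K_n\times K_n\to K_{n+1}$, ${}^{-1}:K_n\to K_{n+1}$), i.e. every formula of continuous logic with parameters from $H$ has the same value in both. Assume that no $K_i$ is an $\mathcal F$-Kazhdan set for $G$. Then for every infinite subset $C\subseteq G$ there is a closed elementary (in continuous logic) subgroup $H$ of $G$ that contains $C$, has the same density character as $C$, and does not have property (T) for $\mathcal F$-continuous representations. -/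

import Mathlib

open scoped Cardinal Pointwise

universe u

/-- The density character of a topological space: the smallest cardinality of a dense subset. -/
noncomputable def densityChar (X : Type u) [TopologicalSpace X] : Cardinal.{u} :=
  sInf {c | ∃ s : Set X, Dense s ∧ #s = c}

/-- `G` is presented as the union of the increasing chain `K 0 ⊆ K 1 ⊆ …` of closed subsets of
finite diameter containing `1`, with `K n * K n ∪ (K n)⁻¹ ⊆ K (n + 1)`, and each map
`K n × K n → K (n + 1)` given by the multiplication is uniformly continuous (that is, it has some
continuity modulus). -/
structure IsPresentation {G : Type u} [Group G] [MetricSpace G] (K : ℕ → Set G) : Prop where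
  isClosed : ∀ n, IsClosed (K n)
  isBounded : ∀ n, Bornology.IsBounded (K n)
  monotone : Monotone K
  iUnion_eq : ⋃ n, K n = Set.univ
  one_mem : ∀ n, (1 : G) ∈ K n
  mul_subset : ∀ n, K n * K n ⊆ K (n + 1)
  inv_subset : ∀ n, (K n)⁻¹ ⊆ K (n + 1)
  uniformContinuousOn_mul : ∀ n, UniformContinuousOn (fun p : G × G => p.1 * p.2) (K n ×ˢ K n)

/-! ### Continuous logic of the many-sorted metric structures `({K n}, ·, ⁻¹, 1)` -/

/-- Terms of sort `s`. The variables of sort `s` are indexed by `ℕ`; multiplication is an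
operation `K s × K s → K (s + 1)`, inversion is an operation `K s → K (s + 1)`, and `1` is a
constant of every sort. -/
inductive SortedTerm : ℕ → Type
  | var (s k : ℕ) : SortedTerm s
  | one (s : ℕ) : SortedTerm s
  | mul {s : ℕ} (t u : SortedTerm s) : SortedTerm (s + 1)
  | inv {s : ℕ} (t : SortedTerm s) : SortedTerm (s + 1)

/-- Formulas of continuous logic. As the sorts have arbitrary finite diameters, values are real
numbers, and addition is not truncated; for every rational `q`, the truncated sum `min (x + y) q`
is obtained from `add`, `min` and `const q`. -/
inductive SortedFormula : Type
  | const (q : ℚ) : SortedFormula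
  | dist {s : ℕ} (t u : SortedTerm s) : SortedFormula
  | half (φ : SortedFormula) : SortedFormula
  | tsub (φ ψ : SortedFormula) : SortedFormula
  | min (φ ψ : SortedFormula) : SortedFormula
  | max (φ ψ : SortedFormula) : SortedFormula
  | absSub (φ ψ : SortedFormula) : SortedFormula
  | compl (φ : SortedFormula) : SortedFormula
  | add (φ ψ : SortedFormula) : SortedFormula
  | sup (s k : ℕ) (φ : SortedFormula) : SortedFormula
  | inf (s k : ℕ) (φ : SortedFormula) : SortedFormula

/-- The value of a term when the variable `var s k` has the value `v s k`. -/
def SortedTerm.eval {G : Type u} [Group G] (v : ℕ → ℕ → G) : {s : ℕ} → SortedTerm s → G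
  | _, .var s k => v s k
  | _, .one _ => 1
  | _, .mul t u => t.eval v * u.eval v
  | _, .inv t => (t.eval v)⁻¹

/-- A term of sort `s` takes its values in `K s`. -/
theorem SortedTerm.eval_mem {G : Type u} [Group G] [MetricSpace G] {K : ℕ → Set G}
    (hK : IsPresentation K) {v : ℕ → ℕ → G} (hv : ∀ s k, v s k ∈ K s) {s : ℕ}
    (t : SortedTerm s) : t.eval v ∈ K s := by
  induction t with
  | var s k => exact hv s k
  | one s => exact hK.one_mem s
  | mul t u iht ihu => exact hK.mul_subset _ (Set.mul_mem_mul iht ihu)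
  | inv t ih => exact hK.inv_subset _ (Set.inv_mem_inv.mpr ih)

/-- The assignment `v` with the value of the variable `var s k` changed to `a`. -/
def updateVar {G : Type u} (v : ℕ → ℕ → G) (s k : ℕ) (a : G) : ℕ → ℕ → G :=
  fun s' k' => if s' = s ∧ k' = k then a else v s' k'

/-- The value of a formula in the structure `({K n}, ·, ⁻¹, 1)`; the quantifiers over a variable of
sort `s` are the supremum and the infimum over `K s`. (For a presentation `K` and an assignment
that respects the sorts, these are taken over non-empty bounded sets of reals.) -/
noncomputable def SortedFormula.eval {G : Type u} [Group G] [MetricSpace G] (K : ℕ → Set G) :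
    SortedFormula → (ℕ → ℕ → G) → ℝ
  | .const q, _ => (q : ℝ)
  | .dist t u, v => Dist.dist (t.eval v) (u.eval v)
  | .half φ, v => φ.eval K v / 2
  | .tsub φ ψ, v => Max.max (φ.eval K v - ψ.eval K v) 0
  | .min φ ψ, v => Min.min (φ.eval K v) (ψ.eval K v)
  | .max φ ψ, v => Max.max (φ.eval K v) (ψ.eval K v)
  | .absSub φ ψ, v => |φ.eval K v - ψ.eval K v|
  | .compl φ, v => 1 - φ.eval K v
  | .add φ ψ, v => φ.eval K v + ψ.eval K v
  | .sup s k φ, v => ⨆ a : K s, φ.eval K (updateVar v s k a)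
  | .inf s k φ, v => ⨅ a : K s, φ.eval K (updateVar v s k a)

/-- The chain of subsets `K n ∩ H` of the subgroup `H`. -/
def restrictChain {G : Type u} [Group G] (K : ℕ → Set G) (H : Subgroup G) : ℕ → Set H :=
  fun n => {h : H | (h : G) ∈ K n}

/-- `({K n ∩ H}, ·, ⁻¹, 1)` is an elementary substructure of `({K n}, ·, ⁻¹, 1)` in continuous
logic: every formula with parameters from `H` has the same value in both structures. -/
def IsElementarySubgroup {G : Type u} [Group G] [MetricSpace G] (K : ℕ → Set G)
    (H : Subgroup G) : Prop :=
  ∀ (φ : SortedFormula) (v : ℕ → ℕ → H), (∀ s k, v s k ∈ restrictChain K H s) →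
    φ.eval (restrictChain K H) v = φ.eval K (fun s k => (v s k : G))

/-! ### Unitary representations and property (T) -/

/-- A family of continuity moduli: `F i ε > 0` for all `i` and all `ε > 0`. -/
def IsModulusFamily (F : ℕ → ℝ → ℝ) : Prop :=
  ∀ i ε, 0 < ε → 0 < F i ε

/-- The unitary representation `π` of `G` is strongly continuous, and for every `i` its action
`K i × B i → B i`, where `B i` is the ball of radius `i`, has the continuity modulus `F i` in each
of its two arguments. -/
structure IsModulusContinuous {G : Type u} [Group G] [MetricSpace G] (K : ℕ → Set G)
    (F : ℕ → ℝ → ℝ) {E : Type u} [NormedAddCommGroup E] [InnerProductSpace ℂ E]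
    (π : G →* (E ≃ₗᵢ[ℂ] E)) : Prop where
  continuous : ∀ v : E, Continuous fun g : G => π g v
  modulus_left : ∀ (i : ℕ) (ε : ℝ), 0 < ε → ∀ x ∈ K i, ∀ y ∈ K i, ∀ v : E, ‖v‖ ≤ i →
    dist x y < F i ε → dist (π x v) (π y v) < ε
  modulus_right : ∀ (i : ℕ) (ε : ℝ), 0 < ε → ∀ x ∈ K i, ∀ v w : E, ‖v‖ ≤ i → ‖w‖ ≤ i →
    dist v w < F i ε → dist (π x v) (π x w) < ε

/-- The representation has an almost `(Q, ε)`-invariant unit vector. (The supremum is over a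
set of numbers in `[0, 2]`; it is `0` if `Q` is empty.) -/
def HasAlmostInvariantUnitVector {G : Type u} [Group G] {E : Type u} [NormedAddCommGroup E]
    [InnerProductSpace ℂ E] (π : G →* (E ≃ₗᵢ[ℂ] E)) (Q : Set G) (ε : ℝ) : Prop :=
  ∃ v : E, ‖v‖ = 1 ∧ (⨆ x : Q, ‖π (x : G) v - v‖) < ε

/-- The closed set `Q` is an `F`-Kazhdan set for `G` (with respect to the chain `K`). -/
def IsModulusKazhdanSet {G : Type u} [Group G] [MetricSpace G] (K : ℕ → Set G)
    (F : ℕ → ℝ → ℝ) (Q : Set G) : Prop :=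
  IsClosed Q ∧ ∃ ε : ℝ, 0 < ε ∧
    ∀ (E : Type u) [NormedAddCommGroup E] [InnerProductSpace ℂ E] [CompleteSpace E]
      (π : G →* (E ≃ₗᵢ[ℂ] E)), IsModulusContinuous K F π →
      HasAlmostInvariantUnitVector π Q ε → ∃ w : E, w ≠ 0 ∧ ∀ g : G, π g w = w

/-- Property (T) for `F`-continuous representations: there is a compact `F`-Kazhdan set. -/
def HasModulusPropertyT {G : Type u} [Group G] [MetricSpace G] (K : ℕ → Set G)
    (F : ℕ → ℝ → ℝ) : Prop :=
  ∃ Q : Set G, IsCompact Q ∧ IsModulusKazhdanSet K F Q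

/-! A single group element can witness that `K i` fails to be a Kazhdan set. Take a representation
of `G` without non-zero invariant vectors and a unit vector `v` that `K i` moves by less than `ε /
4`. Some `g` moves `v` by at least `1 / 2`, for otherwise the element of least norm in the closed
convex hull of the orbit would be a non-zero invariant vector. Let `H` be any subgroup containing
`g`, and subtract from `v` its projection to the `H`-invariant vectors. No displacement under `H`
changes, and since `g` still moves the remainder by `1 / 2`, its norm is at least `1 / 4`. After
normalization it is moved by less than `ε` on `K i ∩ H`, in a representation of `H` without non-zero
invariant vectors (`exists_forall_subgroup_not_kazhdan`).

Hence countably many elements, one for each `i` and each `ε = 1 / (m + 1)`, rule out every subset of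
every `K i ∩ H` as a Kazhdan set. As the `K i` are balls, this covers all compact sets.

These elements and a dense subset of `C` are put into an elementary closed subgroup by the downward
Löwenheim–Skolem theorem. There are countably many formulas, so closing under approximate witnesses
adds nothing beyond `ℵ₀` to the cardinality, and uniform continuity of formulas carries the
Tarski–Vaught test to the closure. One point needs care: an element of the closure lying in `K n`
must be a limit of elements of the small subgroup lying in `K n`. Therefore approximate nearest
points of the sorts are adjoined as well. -/

/-! ### Unitary representations -/

/-- If the displacement of a vector of norm `1` under a unitary representation stays below `1 / 2`,
then there is a non-zero invariant vector. -/
theorem exists_invariant_of_displacement_lt {G : Type*} [Group G] {E : Type*}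
    [NormedAddCommGroup E] [InnerProductSpace ℂ E] [CompleteSpace E] (π : G →* (E ≃ₗᵢ[ℂ] E))
    {v : E} (hv : ‖v‖ = 1) (h : ∀ g, ‖π g v - v‖ < 1 / 2) :
    ∃ w : E, w ≠ 0 ∧ ∀ g, π g w = w := by
  let _ : InnerProductSpace ℝ E := InnerProductSpace.rclikeToReal ℂ E
  set A : Set E := closure (convexHull ℝ (Set.range fun g => π g v)) with hA
  have hAne : A.Nonempty :=
    ⟨v, subset_closure (subset_convexHull ℝ _ ⟨1, by simp⟩)⟩
  have hAconv : Convex ℝ A := (convex_convexHull ℝ _).closure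
  have hAball : A ⊆ Metric.closedBall v (1 / 2) := by
    refine closure_minimal (convexHull_min ?_ (convex_closedBall v _)) Metric.isClosed_closedBall
    rintro _ ⟨g, rfl⟩
    rw [Metric.mem_closedBall, dist_eq_norm]
    exact (h g).le
  have hAinv : ∀ g, ∀ x ∈ A, π g x ∈ A := by
    intro g x hx
    have hc : IsClosed ((π g : E → E) ⁻¹' A) := isClosed_closure.preimage (π g).continuous
    have hsub : convexHull ℝ (Set.range fun g => π g v) ⊆ (π g : E → E) ⁻¹' A := by
      refine convexHull_min ?_ ?_
      · rintro _ ⟨k, rfl⟩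
        refine subset_closure (subset_convexHull ℝ _ ⟨g * k, ?_⟩)
        simp
      · intro a ha b hb s t hs ht hst
        have := hAconv ha hb hs ht hst
        rw [Set.mem_preimage]
        convert this using 1
        rw [map_add]
        congr 1
        · exact map_smul (π g) (s : ℂ) a
        · exact map_smul (π g) (t : ℂ) b
    exact closure_minimal hsub hc hx
  -- The element of least norm is unique, hence fixed. It is non-zero because `A` stays within `1 /
  -- 2` of a unit vector.
  obtain ⟨w, hwA, hw⟩ := exists_norm_eq_iInf_of_complete_convex hAne
    isClosed_closure.isComplete hAconv 0
  have hmin : ∀ x ∈ A, ‖w‖ ≤ ‖x‖ := by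
    intro x hx
    simp only [zero_sub, norm_neg] at hw
    rw [hw]
    exact ciInf_le ⟨0, by rintro _ ⟨y, rfl⟩; exact norm_nonneg _⟩ (⟨x, hx⟩ : A)
  refine ⟨w, ?_, fun g => ?_⟩
  · rintro rfl
    have := hAball hwA
    rw [Metric.mem_closedBall, dist_eq_norm, zero_sub, norm_neg, hv] at this
    norm_num at this
  · have hg := hAinv g w hwA
    -- The midpoint of `w` and `π g w` is no shorter than `w`, so the parallelogram law forces `π g
    -- w = w`.
    have hmid : (2⁻¹ : ℝ) • w + (2⁻¹ : ℝ) • π g w ∈ A :=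
      hAconv hwA hg (by norm_num) (by norm_num) (by norm_num)
    have h1 := hmin _ hmid
    rw [← smul_add, norm_smul] at h1
    have h2 : ‖π g w‖ = ‖w‖ := (π g).norm_map w
    have h3 := parallelogram_law_with_norm ℂ w (π g w)
    rw [h2] at h3
    norm_num at h1
    have h4 : ‖w - π g w‖ * ‖w - π g w‖ ≤ 0 := by nlinarith [norm_nonneg w]
    have h5 : ‖w - π g w‖ = 0 := by nlinarith [norm_nonneg (w - π g w)]
    exact (sub_eq_zero.mp (norm_eq_zero.mp h5)).symm

/-- The subspace of the vectors invariant under a unitary representation. -/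
def invariantSubspace {G : Type*} [Group G] {E : Type*} [NormedAddCommGroup E]
    [InnerProductSpace ℂ E] (π : G →* (E ≃ₗᵢ[ℂ] E)) : Submodule ℂ E where
  carrier := {w | ∀ g, π g w = w}
  add_mem' ha hb g := by rw [map_add, ha g, hb g]
  zero_mem' g := map_zero _
  smul_mem' c w hw g := by rw [map_smul, hw g]

theorem mem_invariantSubspace {G : Type*} [Group G] {E : Type*} [NormedAddCommGroup E]
    [InnerProductSpace ℂ E] {π : G →* (E ≃ₗᵢ[ℂ] E)} {w : E} :
    w ∈ invariantSubspace π ↔ ∀ g, π g w = w := Iff.rfl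

theorem map_mem_invariantSubspace_orthogonal {G : Type*} [Group G] {E : Type*}
    [NormedAddCommGroup E] [InnerProductSpace ℂ E] (π : G →* (E ≃ₗᵢ[ℂ] E)) (g : G) {x : E}
    (hx : x ∈ (invariantSubspace π)ᗮ) : π g x ∈ (invariantSubspace π)ᗮ := by
  rw [Submodule.mem_orthogonal] at hx ⊢
  intro w hw
  rw [← hw g, LinearIsometryEquiv.inner_map_map]
  exact hx w hw

/-- The restriction of a unitary representation to the orthogonal complement of its invariant
vectors. -/
noncomputable def orthogonalInvariantRep {G : Type*} [Group G] {E : Type*} [NormedAddCommGroup E]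
    [InnerProductSpace ℂ E] (π : G →* (E ≃ₗᵢ[ℂ] E)) :
    G →* ((invariantSubspace π)ᗮ ≃ₗᵢ[ℂ] (invariantSubspace π)ᗮ) where
  toFun g :=
    { toFun := fun x => ⟨π g x, map_mem_invariantSubspace_orthogonal π g x.2⟩
      invFun := fun x => ⟨π g⁻¹ x, map_mem_invariantSubspace_orthogonal π g⁻¹ x.2⟩
      map_add' := fun x y => Subtype.ext (by simp)
      map_smul' := fun c x => Subtype.ext (by simp)
      left_inv := fun x => Subtype.ext (by simp)
      right_inv := fun x => Subtype.ext (by simp)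
      norm_map' := fun x => (π g).norm_map x }
  map_one' := by ext x; simp
  map_mul' g h := by ext x; simp

@[simp] theorem coe_orthogonalInvariantRep_apply {G : Type*} [Group G] {E : Type*}
    [NormedAddCommGroup E] [InnerProductSpace ℂ E] (π : G →* (E ≃ₗᵢ[ℂ] E)) (g : G)
    (x : (invariantSubspace π)ᗮ) : (orthogonalInvariantRep π g x : E) = π g x := rfl

/-- A fixed vector of the complement is invariant, hence orthogonal to itself. -/
theorem eq_zero_of_orthogonalInvariantRep_apply_eq {G : Type*} [Group G] {E : Type*}
    [NormedAddCommGroup E] [InnerProductSpace ℂ E] (π : G →* (E ≃ₗᵢ[ℂ] E))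
    {x : (invariantSubspace π)ᗮ} (hx : ∀ g, orthogonalInvariantRep π g x = x) : x = 0 := by
  have hmem : (x : E) ∈ invariantSubspace π := fun g => congrArg Subtype.val (hx g)
  have h0 := (Submodule.mem_orthogonal _ _).mp x.2 _ hmem
  exact Subtype.ext (inner_self_eq_zero.mp h0)

theorem isClosed_invariantSubspace {G : Type*} [Group G] {E : Type*} [NormedAddCommGroup E]
    [InnerProductSpace ℂ E] (π : G →* (E ≃ₗᵢ[ℂ] E)) :
    IsClosed (invariantSubspace π : Set E) := by
  have : (invariantSubspace π : Set E) = ⋂ g, {w | π g w = w} := by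
    ext w; simp [mem_invariantSubspace]
  rw [this]
  exact isClosed_iInter fun g => isClosed_eq (π g).continuous continuous_id

theorem IsModulusContinuous.orthogonalInvariantRep_subtype {G : Type u} [Group G] [MetricSpace G]
    {K : ℕ → Set G} {F : ℕ → ℝ → ℝ} {E : Type u} [NormedAddCommGroup E] [InnerProductSpace ℂ E]
    {π : G →* (E ≃ₗᵢ[ℂ] E)} (hπ : IsModulusContinuous K F π) (H : Subgroup G) :
    IsModulusContinuous (restrictChain K H) F (orthogonalInvariantRep (π.comp H.subtype)) where
  continuous v := ((hπ.continuous v).comp continuous_subtype_val).subtype_mk _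
  modulus_left i ε hε x hx y hy v hv hxy := hπ.modulus_left i ε hε x hx y hy v hv hxy
  modulus_right i ε hε x hx v w hv hw hvw := hπ.modulus_right i ε hε x hx v w hv hw hvw

/-- If `K i` is not a Kazhdan set, then there is a single element `g` such that no subset of `K i`
is a Kazhdan set with constant `ε` of a subgroup containing `g`. -/
theorem exists_forall_subgroup_not_kazhdan {G : Type u} [Group G] [MetricSpace G] {K : ℕ → Set G}
    (hK : IsPresentation K) {F : ℕ → ℝ → ℝ} {i : ℕ} (hi : ¬ IsModulusKazhdanSet K F (K i))
    {ε : ℝ} (hε : 0 < ε) :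
    ∃ g : G, ∀ H : Subgroup G, g ∈ H → ∀ Q ⊆ restrictChain K H i,
      ∃ (E : Type u) (_ : NormedAddCommGroup E) (_ : InnerProductSpace ℂ E) (_ : CompleteSpace E)
        (π : H →* (E ≃ₗᵢ[ℂ] E)), IsModulusContinuous (restrictChain K H) F π ∧
        HasAlmostInvariantUnitVector π Q ε ∧ ¬ ∃ w : E, w ≠ 0 ∧ ∀ g : H, π g w = w := by
  have hi' : ∃ (E : Type u) (_ : NormedAddCommGroup E) (_ : InnerProductSpace ℂ E)
      (_ : CompleteSpace E) (π : G →* (E ≃ₗᵢ[ℂ] E)), IsModulusContinuous K F π ∧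
        HasAlmostInvariantUnitVector π (K i) (ε / 4) ∧
        ¬ ∃ w : E, w ≠ 0 ∧ ∀ g : G, π g w = w := by
    by_contra hcon
    -- The factor `4` is lost when a vector of norm at least `1 / 4` is normalized.
    refine hi ⟨hK.isClosed i, ε / 4, by positivity, fun E _ _ _ π h1 h2 => ?_⟩
    by_contra h3
    exact hcon ⟨E, _, _, ‹_›, π, h1, h2, h3⟩
  obtain ⟨E, _, _, _, π, hπ, ⟨v, hv, hlt⟩, hno⟩ := hi'
  have hmove : ∃ g, 1 / 2 ≤ ‖π g v - v‖ := by
    by_contra! hcon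
    exact hno (exists_invariant_of_displacement_lt π hv hcon)
  obtain ⟨g, hg⟩ := hmove
  refine ⟨g, fun H hgH Q hQ => ?_⟩
  set ρ := π.comp H.subtype with hρ
  set W := invariantSubspace ρ with hW
  have : CompleteSpace W := (isClosed_invariantSubspace ρ).completeSpace_coe
  set v₀ : W := W.orthogonalProjectionOnto v with hv₀
  set v₁ : Wᗮ := ⟨v - v₀, W.sub_starProjection_mem_orthogonal v⟩ with hv₁
  have hdisp : ∀ h : H, ‖orthogonalInvariantRep ρ h v₁ - v₁‖ = ‖π h v - v‖ := by
    intro h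
    have h0 : π h (v₀ : E) = v₀ := v₀.2 h
    rw [Submodule.coe_norm, Submodule.coe_sub, coe_orthogonalInvariantRep_apply]
    change ‖π h (v - v₀) - (v - v₀)‖ = _
    rw [map_sub, h0, sub_sub_sub_cancel_right]
  -- The displacement of `v₁` by `g` is at least `1 / 2` and at most `2 * ‖v₁‖`.
  have hnorm : 1 / 4 ≤ ‖v₁‖ := by
    have h1 := hdisp ⟨g, hgH⟩
    have h2 := norm_sub_le (orthogonalInvariantRep ρ ⟨g, hgH⟩ v₁) v₁
    rw [LinearIsometryEquiv.norm_map, h1] at h2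
    change ‖π g v - v‖ ≤ _ at h2
    linarith
  have hpos : 0 < ‖v₁‖ := by linarith
  have hbdd : BddAbove (Set.range fun x : K i => ‖π (x : G) v - v‖) := by
    refine ⟨2, ?_⟩
    rintro _ ⟨x, rfl⟩
    refine (norm_sub_le _ _).trans ?_
    rw [LinearIsometryEquiv.norm_map, hv]; norm_num
  have hsup0 : 0 ≤ ⨆ x : K i, ‖π (x : G) v - v‖ := Real.iSup_nonneg fun _ => norm_nonneg _
  refine ⟨(Wᗮ : Submodule ℂ E), inferInstance, inferInstance, inferInstance,
    orthogonalInvariantRep ρ, hπ.orthogonalInvariantRep_subtype H,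
    ⟨((‖v₁‖⁻¹ : ℝ) : ℂ) • v₁, ?_, ?_⟩, ?_⟩
  · rw [norm_smul, Complex.norm_real, norm_inv, norm_norm, inv_mul_cancel₀ hpos.ne']
  · refine lt_of_le_of_lt (b := 4 * ⨆ x : K i, ‖π (x : G) v - v‖) ?_ (by linarith)
    refine Real.iSup_le (fun x => ?_) (by positivity)
    rw [map_smul, ← smul_sub, norm_smul, Complex.norm_real, norm_inv, norm_norm, hdisp]
    have h1 : ‖π ((x : H) : G) v - v‖ ≤ ⨆ x : K i, ‖π (x : G) v - v‖ :=
      le_ciSup hbdd (⟨_, hQ x.2⟩ : K i)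
    have h2 : ‖v₁‖⁻¹ ≤ 4 := by
      rw [inv_le_comm₀ hpos (by norm_num)]; linarith
    gcongr
  · rintro ⟨w, hw0, hw⟩
    exact hw0 (eq_zero_of_orthogonalInvariantRep_apply_eq ρ hw)

/-- If the `K i` are balls, then compact subsets of `Γ` are contained in some `K i`. -/
theorem exists_subset_restrictChain_of_isCompact {G : Type u} [Group G] [MetricSpace G]
    {K : ℕ → Set G} (hK : IsPresentation K)
    (hball : ∀ i, ∃ r : ℝ, K i = Metric.closedBall (1 : G) r) (H : Subgroup G) {Q : Set H}
    (hQ : IsCompact Q) : ∃ i, Q ⊆ restrictChain K H i := by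
  rcases Q.eq_empty_or_nonempty with rfl | hne
  · exact ⟨0, Set.empty_subset _⟩
  -- A ball around `1` that contains a farthest point of `Q` contains all of `Q`.
  obtain ⟨q, -, hq⟩ := hQ.exists_isMaxOn hne
    (f := fun x : H => dist (x : G) 1) (by fun_prop)
  have : (q : G) ∈ ⋃ n, K n := by rw [hK.iUnion_eq]; trivial
  obtain ⟨i, hi⟩ := Set.mem_iUnion.mp this
  obtain ⟨r, hr⟩ := hball i
  refine ⟨i, fun x hx => ?_⟩
  change (x : G) ∈ K i
  rw [hr, Metric.mem_closedBall] at hi ⊢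
  exact (hq hx).trans hi

/-! ### Hulls and density characters -/

/-- The closure of a set under an operation that assigns a countable set to each finite list. -/
theorem exists_superset_closed_under_list {X : Type u} (Φ : List X → Set X)
    (hΦ : ∀ l, (Φ l).Countable) (S : Set X) :
    ∃ T : Set X, S ⊆ T ∧ #T ≤ max #S ℵ₀ ∧ ∀ l : List X, (∀ x ∈ l, x ∈ T) → Φ l ⊆ T := by
  set step : Set X → Set X := fun T => T ∪ ⋃ l : List T, Φ (l.map Subtype.val) with hstep
  set A : ℕ → Set X := fun n => step^[n] S with hA
  have hsucc : ∀ n, A (n + 1) = step (A n) := fun n => Function.iterate_succ_apply' _ _ _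
  have hmono : Monotone A := monotone_nat_of_le_succ fun n => by
    rw [hsucc]; exact Set.subset_union_left
  have hcard : ∀ n, #(A n) ≤ max #S ℵ₀ := by
    intro n
    induction n with
    | zero => exact le_max_left _ _
    | succ n ih =>
      have hω : ℵ₀ ≤ max #S ℵ₀ := le_max_right _ _
      rw [hsucc]
      refine (Cardinal.mk_union_le _ _).trans ((add_le_add ih ?_).trans
        (Cardinal.add_eq_self hω).le)
      refine (Cardinal.mk_iUnion_le _).trans ?_
      have h1 : #(List (A n)) ≤ max #S ℵ₀ :=
        (Cardinal.mk_list_le_max _).trans (max_le hω ih)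
      have h2 : ⨆ l : List (A n), #(Φ (l.map Subtype.val)) ≤ ℵ₀ :=
        ciSup_le' fun l => Cardinal.mk_le_aleph0_iff.mpr (hΦ _)
      exact (mul_le_mul' h1 (h2.trans hω)).trans (Cardinal.mul_eq_self hω).le
  refine ⟨⋃ n, A n, Set.subset_iUnion A 0, ?_, fun l hl => ?_⟩
  · have hω : ℵ₀ ≤ max #S ℵ₀ := le_max_right _ _
    have := Cardinal.mk_iUnion_le_lift A
    simp only [Cardinal.lift_uzero, Cardinal.mk_nat, Cardinal.lift_aleph0] at this
    refine this.trans ?_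
    exact (mul_le_mul' hω (ciSup_le' hcard)).trans (Cardinal.mul_eq_self hω).le
  · have : ∃ n, ∀ x ∈ l, x ∈ A n := by
      induction l with
      | nil => exact ⟨0, by simp⟩
      | cons a l ih =>
        obtain ⟨n, hn⟩ := ih fun x hx => hl x (List.mem_cons_of_mem _ hx)
        obtain ⟨m, hm⟩ := Set.mem_iUnion.mp (hl a List.mem_cons_self)
        refine ⟨max n m, fun x hx => ?_⟩
        rcases List.mem_cons.mp hx with rfl | hx
        · exact hmono (le_max_right _ _) hm
        · exact hmono (le_max_left _ _) (hn x hx)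
    obtain ⟨n, hn⟩ := this
    lift l to List (A n) using hn
    refine Set.Subset.trans ?_ (Set.subset_iUnion A (n + 1))
    rw [hsucc]
    exact (Set.subset_iUnion (fun l : List (A n) => Φ (l.map Subtype.val)) l).trans
      Set.subset_union_right

theorem densityChar_le {X : Type u} [TopologicalSpace X] {s : Set X} (hs : Dense s) :
    densityChar X ≤ #s := csInf_le' ⟨s, hs, rfl⟩

theorem exists_dense_card_eq_densityChar (X : Type u) [TopologicalSpace X] :
    ∃ s : Set X, Dense s ∧ #s = densityChar X :=
  csInf_mem (s := {c | ∃ s : Set X, Dense s ∧ #s = c}) ⟨_, Set.univ, dense_univ, rfl⟩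

theorem aleph0_le_densityChar (X : Type u) [TopologicalSpace X] [T1Space X] [Infinite X] :
    ℵ₀ ≤ densityChar X := by
  obtain ⟨s, hs, hcard⟩ := exists_dense_card_eq_densityChar X
  rw [← hcard, Cardinal.aleph0_le_mk_iff, Set.infinite_coe_iff]
  intro hfin
  have : s = Set.univ := by rw [← hfin.isClosed.closure_eq, hs.closure_eq]
  exact Set.infinite_univ (this ▸ hfin)

/-- The density character of a metric space bounds that of its infinite subspaces. -/
theorem densityChar_le_of_isometry {X Y : Type u} [MetricSpace X] [MetricSpace Y] [Infinite X]
    {f : X → Y} (hf : Isometry f) : densityChar X ≤ densityChar Y := by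
  have : Infinite Y := Infinite.of_injective f hf.injective
  obtain ⟨s, hs, hcard⟩ := exists_dense_card_eq_densityChar Y
  have hω := aleph0_le_densityChar Y
  obtain ⟨x₀⟩ : Nonempty X := inferInstance
  -- One point of `X` is chosen near each point of the dense set at each scale, where there is one;
  -- `x₀` is a default value.
  have hex : ∀ p : s × ℕ, ∃ x : X, (∃ z, dist (f z) p.1 < 1 / ((p.2 : ℝ) + 1)) →
      dist (f x) p.1 < 1 / ((p.2 : ℝ) + 1) := by
    intro p
    by_cases h : ∃ z, dist (f z) p.1 < 1 / ((p.2 : ℝ) + 1)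
    · exact ⟨h.choose, fun _ => h.choose_spec⟩
    · exact ⟨x₀, fun h' => absurd h' h⟩
  choose c hc using hex
  have hdense : Dense (Set.range c) := by
    intro x
    rw [Metric.mem_closure_iff]
    intro ε hε
    obtain ⟨n, hn⟩ := exists_nat_one_div_lt (half_pos hε)
    obtain ⟨y, hy, hxy⟩ := Metric.mem_closure_iff.mp (hs (f x)) _
      (Nat.one_div_pos_of_nat (α := ℝ) (n := n))
    have h1 := hc (⟨y, hy⟩, n) ⟨x, hxy⟩
    refine ⟨_, ⟨(⟨y, hy⟩, n), rfl⟩, ?_⟩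
    rw [← hf.dist_eq]
    have := dist_triangle_right (f x) (f (c (⟨y, hy⟩, n))) y
    simp only at h1
    linarith
  refine (densityChar_le hdense).trans (Cardinal.mk_range_le.trans ?_)
  rw [Cardinal.mk_prod, Cardinal.lift_uzero, Cardinal.mk_nat, Cardinal.lift_aleph0, hcard]
  exact (Cardinal.mul_le_max_of_aleph0_le_left hω).trans (max_le le_rfl hω)

/-- Small subgroups that contain approximate maximizers, on the sets `K n`, of countably many
functions with parameters from the subgroup. -/
theorem exists_subgroup_approx_maximizers {G : Type u} [Group G] (K : ℕ → Set G)
    (hne : ∀ n, (K n).Nonempty) {ι : Type*} [Countable ι] (f : ι → List G → G → ℝ) (S : Set G) :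
    ∃ H : Subgroup G, S ⊆ H ∧ #H ≤ max #S ℵ₀ ∧ ∀ (i : ι) (l : List G) (n : ℕ) (ε : ℝ), 0 < ε →
      (∀ x ∈ l, x ∈ H) → BddAbove (f i l '' K n) →
        ∃ b ∈ H, b ∈ K n ∧ ∀ a ∈ K n, f i l a ≤ f i l b + ε := by
  have hex : ∀ (l : List G) (p : ι × ℕ × ℕ), ∃ b : G, BddAbove (f p.1 l '' K p.2.1) →
      b ∈ K p.2.1 ∧ ∀ a ∈ K p.2.1, f p.1 l a ≤ f p.1 l b + 1 / ((p.2.2 : ℝ) + 1) := by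
    rintro l ⟨i, n, m⟩
    by_cases h : BddAbove (f i l '' K n)
    · obtain ⟨_, ⟨b, hb, rfl⟩, hlt⟩ := exists_lt_of_lt_csSup ((hne n).image (f i l))
        (sub_lt_self _ (Nat.one_div_pos_of_nat (α := ℝ) (n := m)))
      refine ⟨b, fun _ => ⟨hb, fun a ha => ?_⟩⟩
      have := le_csSup h (Set.mem_image_of_mem _ ha)
      simp only
      linarith
    · exact ⟨1, fun h' => absurd h' h⟩
  choose b hb using hex
  obtain ⟨T, hST, hcard, hT⟩ := exists_superset_closed_under_list
    -- Lists of length two, zero and one give closure under product, unit and inverse.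
    (fun l : List G => {l.prod, l.prod⁻¹} ∪ Set.range (b l))
    (fun l => ((Set.toFinite _).countable).union (Set.countable_range _)) S
  refine ⟨{ carrier := T, mul_mem' := ?_, one_mem' := ?_, inv_mem' := ?_ }, hST, hcard, ?_⟩
  · intro x y hx hy
    refine hT [x, y] (by simp [hx, hy]) (Or.inl (Or.inl ?_))
    simp
  · exact hT [] (by simp) (Or.inl (Or.inl (by simp)))
  · intro x hx
    refine hT [x] (by simpa using hx) (Or.inl (Or.inr ?_))
    simp
  · intro i l n ε hε hl hbdd
    obtain ⟨m, hm⟩ := exists_nat_one_div_lt hε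
    obtain ⟨h1, h2⟩ := hb l (i, n, m) hbdd
    exact ⟨b l (i, n, m), hT l hl (Or.inr ⟨_, rfl⟩), h1, fun a ha => (h2 a ha).trans (by
      simp only; linarith)⟩

/-! ### Terms and formulas -/

/-- A numerical code of a term. -/
def SortedTerm.code : {s : ℕ} → SortedTerm s → ℕ
  | _, .var s k => Nat.pair 0 (Nat.pair s k)
  | _, .one s => Nat.pair 1 s
  | _, .mul t u => Nat.pair 2 (Nat.pair t.code u.code)
  | _, .inv t => Nat.pair 3 t.code

theorem SortedTerm.code_injective {s : ℕ} :
    Function.Injective (SortedTerm.code : SortedTerm s → ℕ) := by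
  intro t
  induction t with
  | var s k => intro u h; cases u <;> simp_all [SortedTerm.code, Nat.pair_eq_pair]
  | one s => intro u h; cases u <;> simp_all [SortedTerm.code, Nat.pair_eq_pair]
  | mul t₁ t₂ ih₁ ih₂ =>
    intro u h
    cases u <;> simp only [SortedTerm.code, Nat.pair_eq_pair] at h
    case mul u₁ u₂ => rw [ih₁ h.2.1, ih₂ h.2.2]
    all_goals omega
  | inv t ih =>
    intro u h
    cases u <;> simp only [SortedTerm.code, Nat.pair_eq_pair] at h
    case inv u => rw [ih h.2]
    all_goals omega

/-- A numerical code of a formula. -/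
def SortedFormula.code : SortedFormula → ℕ
  | .const q => Nat.pair 0 (Encodable.encode q)
  -- The sort is recorded because `SortedTerm.code_injective` compares terms of one sort only.
  | .dist (s := s) t u => Nat.pair 1 (Nat.pair s (Nat.pair t.code u.code))
  | .half φ => Nat.pair 2 φ.code
  | .tsub φ ψ => Nat.pair 3 (Nat.pair φ.code ψ.code)
  | .min φ ψ => Nat.pair 4 (Nat.pair φ.code ψ.code)
  | .max φ ψ => Nat.pair 5 (Nat.pair φ.code ψ.code)
  | .absSub φ ψ => Nat.pair 6 (Nat.pair φ.code ψ.code)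
  | .compl φ => Nat.pair 7 φ.code
  | .add φ ψ => Nat.pair 8 (Nat.pair φ.code ψ.code)
  | .sup s k φ => Nat.pair 9 (Nat.pair s (Nat.pair k φ.code))
  | .inf s k φ => Nat.pair 10 (Nat.pair s (Nat.pair k φ.code))

theorem SortedFormula.code_injective : Function.Injective SortedFormula.code := by
  intro φ
  induction φ with
  | const q =>
    intro ψ h
    cases ψ <;> simp only [SortedFormula.code, Nat.pair_eq_pair] at h
    case const q' => rw [Encodable.encode_injective h.2]
    all_goals omega
  | @dist s t u =>
    intro ψ h
    cases ψ <;> simp only [SortedFormula.code, Nat.pair_eq_pair] at h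
    case dist s' t' u' =>
      obtain ⟨-, rfl, h1, h2⟩ := h
      rw [SortedTerm.code_injective h1, SortedTerm.code_injective h2]
    all_goals omega
  | half φ ih | compl φ ih =>
    intro ψ h
    cases ψ <;> simp only [SortedFormula.code, Nat.pair_eq_pair] at h <;>
    first
    | omega
    | rw [ih h.2]
  | tsub φ₁ φ₂ ih₁ ih₂ | min φ₁ φ₂ ih₁ ih₂ | max φ₁ φ₂ ih₁ ih₂ | absSub φ₁ φ₂ ih₁ ih₂
  | add φ₁ φ₂ ih₁ ih₂ =>
    intro ψ h
    cases ψ <;> simp only [SortedFormula.code, Nat.pair_eq_pair] at h <;>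
    first
    | omega
    | rw [ih₁ h.2.1, ih₂ h.2.2]
  | sup s k φ ih | inf s k φ ih =>
    intro ψ h
    cases ψ <;> simp only [SortedFormula.code, Nat.pair_eq_pair] at h <;>
    first
    | omega
    | rw [h.2.1, h.2.2.1, ih h.2.2.2]

instance : Countable SortedFormula := SortedFormula.code_injective.countable

/-- The value of a term depends on finitely many variables only. -/
theorem SortedTerm.exists_eval_congr {G : Type u} [Group G] {s : ℕ} (t : SortedTerm s) :
    ∃ M : ℕ, ∀ v w : ℕ → ℕ → G, (∀ s k, Nat.pair s k < M → v s k = w s k) →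
      t.eval v = t.eval w := by
  induction t with
  | var s k => exact ⟨Nat.pair s k + 1, fun v w h => h s k (Nat.lt_succ_self _)⟩
  | one s => exact ⟨0, fun v w _ => rfl⟩
  | mul t u iht ihu =>
    obtain ⟨M, hM⟩ := iht
    obtain ⟨N, hN⟩ := ihu
    refine ⟨max M N, fun v w h => ?_⟩
    simp only [SortedTerm.eval]
    rw [hM v w fun s k hk => h s k (lt_max_of_lt_left hk),
      hN v w fun s k hk => h s k (lt_max_of_lt_right hk)]
  | inv t ih =>
    obtain ⟨M, hM⟩ := ih
    exact ⟨M, fun v w h => by simp only [SortedTerm.eval]; rw [hM v w h]⟩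

theorem updateVar_congr {G : Type u} {M : ℕ} {v w : ℕ → ℕ → G}
    (h : ∀ s k, Nat.pair s k < M → v s k = w s k) (s k : ℕ) (a : G) :
    ∀ s' k', Nat.pair s' k' < M → updateVar v s k a s' k' = updateVar w s k a s' k' := by
  intro s' k' hk
  simp only [updateVar]
  split_ifs
  · rfl
  · exact h s' k' hk

/-- The value of a formula depends on finitely many variables only. -/
theorem SortedFormula.exists_eval_congr {G : Type u} [Group G] [MetricSpace G] (K : ℕ → Set G)
    (φ : SortedFormula) :
    ∃ M : ℕ, ∀ v w : ℕ → ℕ → G, (∀ s k, Nat.pair s k < M → v s k = w s k) →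
      φ.eval K v = φ.eval K w := by
  induction φ with
  | const q => exact ⟨0, fun _ _ _ => rfl⟩
  | dist t u =>
    obtain ⟨M, hM⟩ := t.exists_eval_congr (G := G)
    obtain ⟨N, hN⟩ := u.exists_eval_congr (G := G)
    refine ⟨Max.max M N, fun v w h => ?_⟩
    simp only [SortedFormula.eval]
    rw [hM v w fun s k hk => h s k (lt_max_of_lt_left hk),
      hN v w fun s k hk => h s k (lt_max_of_lt_right hk)]
  | half φ ih | compl φ ih =>
    obtain ⟨M, hM⟩ := ih
    exact ⟨M, fun v w h => by simp only [SortedFormula.eval]; rw [hM v w h]⟩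
  | tsub φ ψ ihφ ihψ | min φ ψ ihφ ihψ | max φ ψ ihφ ihψ | absSub φ ψ ihφ ihψ | add φ ψ ihφ ihψ =>
    obtain ⟨M, hM⟩ := ihφ
    obtain ⟨N, hN⟩ := ihψ
    refine ⟨Max.max M N, fun v w h => ?_⟩
    simp only [SortedFormula.eval]
    rw [hM v w fun s k hk => h s k (lt_max_of_lt_left hk),
      hN v w fun s k hk => h s k (lt_max_of_lt_right hk)]
  | sup s k φ ih | inf s k φ ih =>
    obtain ⟨M, hM⟩ := ih
    refine ⟨M, fun v w h => ?_⟩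
    simp only [SortedFormula.eval]
    congr 1
    funext a
    exact hM _ _ (updateVar_congr h s k a)

theorem updateVar_mem {G : Type u} {K : ℕ → Set G} {v : ℕ → ℕ → G} (hv : ∀ s k, v s k ∈ K s)
    {s : ℕ} (k : ℕ) {a : G} (ha : a ∈ K s) : ∀ s' k', updateVar v s k a s' k' ∈ K s' := by
  intro s' k'
  simp only [updateVar]
  split_ifs with h
  · exact h.1 ▸ ha
  · exact hv s' k'

theorem updateVar_dist_lt {G : Type u} [MetricSpace G] {v w : ℕ → ℕ → G} {δ : ℝ} (hδ : 0 < δ)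
    (h : ∀ s k, dist (v s k) (w s k) < δ) (s k : ℕ) (a : G) :
    ∀ s' k', dist (updateVar v s k a s' k') (updateVar w s k a s' k') < δ := by
  intro s' k'
  simp only [updateVar]
  split_ifs
  · simpa using hδ
  · exact h s' k'

/-- Inversion is uniformly continuous on the sets `K n` of a presentation. -/
theorem IsPresentation.inv_dist_lt {G : Type u} [Group G] [MetricSpace G] {K : ℕ → Set G}
    (hK : IsPresentation K) (n : ℕ) {ε : ℝ} (hε : 0 < ε) :
    ∃ δ > 0, ∀ x ∈ K n, ∀ y ∈ K n, dist x y < δ → dist x⁻¹ y⁻¹ < ε := by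
  -- If `x` is close to `y`, then `x⁻¹ * y` is close to `1`, and multiplying by `y⁻¹` shows that
  -- `x⁻¹` is close to `y⁻¹`. The first product has factors in `K (n + 1)`, the second in `K (n +
  -- 2)`.
  obtain ⟨η, hη, h1⟩ := Metric.uniformContinuousOn_iff.mp (hK.uniformContinuousOn_mul (n + 2)) ε hε
  obtain ⟨δ, hδ, h2⟩ := Metric.uniformContinuousOn_iff.mp (hK.uniformContinuousOn_mul (n + 1)) η hη
  refine ⟨δ, hδ, fun x hx y hy hxy => ?_⟩
  have hx1 := hK.monotone (Nat.le_succ n) hx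
  have hy1 := hK.monotone (Nat.le_succ n) hy
  have hxi : x⁻¹ ∈ K (n + 1) := hK.inv_subset n (Set.inv_mem_inv.mpr hx)
  have hyi : y⁻¹ ∈ K (n + 1) := hK.inv_subset n (Set.inv_mem_inv.mpr hy)
  have hyi2 := hK.monotone (Nat.le_succ (n + 1)) hyi
  have h3 := h2 (x⁻¹, y) ⟨hxi, hy1⟩ (x⁻¹, x) ⟨hxi, hx1⟩ (by
    simpa [Prod.dist_eq, dist_comm y x] using hxy)
  have h4 := h1 (x⁻¹ * y, y⁻¹) ⟨hK.mul_subset _ (Set.mul_mem_mul hxi hy1), hyi2⟩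
    (x⁻¹ * x, y⁻¹) ⟨hK.mul_subset _ (Set.mul_mem_mul hxi hx1), hyi2⟩ (by
      simpa [Prod.dist_eq] using h3)
  simpa using h4

theorem SortedTerm.eval_dist_lt {G : Type u} [Group G] [MetricSpace G] {K : ℕ → Set G}
    (hK : IsPresentation K) {s : ℕ} (t : SortedTerm s) {ε : ℝ} (hε : 0 < ε) :
    ∃ δ > 0, ∀ v w : ℕ → ℕ → G, (∀ s k, v s k ∈ K s) → (∀ s k, w s k ∈ K s) →
      (∀ s k, dist (v s k) (w s k) < δ) → dist (t.eval v) (t.eval w) < ε := by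
  induction t generalizing ε with
  | var s k => exact ⟨ε, hε, fun v w _ _ h => h s k⟩
  | one s => exact ⟨1, one_pos, fun v w _ _ _ => by simpa [SortedTerm.eval] using hε⟩
  | @mul s t u iht ihu =>
    obtain ⟨η, hη, h⟩ := Metric.uniformContinuousOn_iff.mp (hK.uniformContinuousOn_mul s) ε hε
    obtain ⟨δ₁, hδ₁, h₁⟩ := iht hη
    obtain ⟨δ₂, hδ₂, h₂⟩ := ihu hη
    refine ⟨min δ₁ δ₂, lt_min hδ₁ hδ₂, fun v w hv hw hvw => ?_⟩
    refine h (t.eval v, u.eval v) ⟨t.eval_mem hK hv, u.eval_mem hK hv⟩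
      (t.eval w, u.eval w) ⟨t.eval_mem hK hw, u.eval_mem hK hw⟩ ?_
    rw [Prod.dist_eq]
    exact max_lt (h₁ v w hv hw fun s k => (hvw s k).trans_le (min_le_left _ _))
      (h₂ v w hv hw fun s k => (hvw s k).trans_le (min_le_right _ _))
  | @inv s t ih =>
    obtain ⟨η, hη, h⟩ := hK.inv_dist_lt s hε
    obtain ⟨δ, hδ, h₁⟩ := ih hη
    exact ⟨δ, hδ, fun v w hv hw hvw =>
      h _ (t.eval_mem hK hv) _ (t.eval_mem hK hw) (h₁ v w hv hw hvw)⟩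

/-- Formulas are bounded on the assignments that respect the sorts. -/
theorem SortedFormula.exists_abs_eval_le {G : Type u} [Group G] [MetricSpace G] {K : ℕ → Set G}
    (hK : IsPresentation K) (φ : SortedFormula) :
    ∃ B : ℝ, 0 ≤ B ∧ ∀ v : ℕ → ℕ → G, (∀ s k, v s k ∈ K s) → |φ.eval K v| ≤ B := by
  induction φ with
  | const q => exact ⟨|(q : ℝ)|, abs_nonneg _, fun _ _ => le_rfl⟩
  | @dist s t u =>
    obtain ⟨B, hB⟩ := Metric.isBounded_iff.mp (hK.isBounded s)
    refine ⟨|B|, abs_nonneg _, fun v hv => ?_⟩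
    simp only [SortedFormula.eval]
    rw [abs_of_nonneg dist_nonneg]
    exact (hB (t.eval_mem hK hv) (u.eval_mem hK hv)).trans (le_abs_self _)
  | half φ ih | compl φ ih =>
    obtain ⟨B, hB0, hB⟩ := ih
    refine ⟨1 + B, by positivity, fun v hv => ?_⟩
    have := abs_le.mp (hB v hv)
    simp only [SortedFormula.eval]
    rw [abs_le]
    constructor <;> linarith
  | tsub φ ψ ihφ ihψ | min φ ψ ihφ ihψ | max φ ψ ihφ ihψ | absSub φ ψ ihφ ihψ | add φ ψ ihφ ihψ =>
    obtain ⟨B, hB0, hB⟩ := ihφ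
    obtain ⟨B', hB0', hB'⟩ := ihψ
    refine ⟨B + B', by positivity, fun v hv => ?_⟩
    have h₁ := abs_le.mp (hB v hv)
    have h₂ := abs_le.mp (hB' v hv)
    simp only [SortedFormula.eval]
    grind
  | sup s k φ ih | inf s k φ ih =>
    obtain ⟨B, hB0, hB⟩ := ih
    refine ⟨B, hB0, fun v hv => ?_⟩
    have hb : ∀ a : K s, |φ.eval K (updateVar v s k a)| ≤ B := fun a =>
      hB _ (updateVar_mem hv k a.2)
    have : Nonempty (K s) := ⟨⟨1, hK.one_mem s⟩⟩
    simp only [SortedFormula.eval]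
    first
    | exact abs_le.mpr ⟨(abs_le.mp (hb ⟨1, hK.one_mem s⟩)).1.trans
          (le_ciSup (f := fun a : K s => φ.eval K (updateVar v s k a))
            ⟨B, by rintro _ ⟨a, rfl⟩; exact (abs_le.mp (hb a)).2⟩ ⟨1, hK.one_mem s⟩),
        ciSup_le fun a => (abs_le.mp (hb a)).2⟩
    | exact abs_le.mpr ⟨le_ciInf fun a => (abs_le.mp (hb a)).1,
        (ciInf_le (f := fun a : K s => φ.eval K (updateVar v s k a))
            ⟨-B, by rintro _ ⟨a, rfl⟩; exact (abs_le.mp (hb a)).1⟩ ⟨1, hK.one_mem s⟩).trans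
          (abs_le.mp (hb ⟨1, hK.one_mem s⟩)).2⟩

/-- Without boundedness the real supremum would be a default value and carry no information. -/
theorem SortedFormula.bddAbove_range_eval {G : Type u} [Group G] [MetricSpace G] {K : ℕ → Set G}
    (hK : IsPresentation K) (φ : SortedFormula) {v : ℕ → ℕ → G} (hv : ∀ s k, v s k ∈ K s)
    (s k : ℕ) : BddAbove (Set.range fun a : K s => φ.eval K (updateVar v s k a)) := by
  obtain ⟨B, -, hB⟩ := φ.exists_abs_eval_le hK
  refine ⟨B, ?_⟩
  rintro _ ⟨a, rfl⟩
  exact (abs_le.mp (hB _ (updateVar_mem hv k a.2))).2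

theorem SortedFormula.bddBelow_range_eval {G : Type u} [Group G] [MetricSpace G] {K : ℕ → Set G}
    (hK : IsPresentation K) (φ : SortedFormula) {v : ℕ → ℕ → G} (hv : ∀ s k, v s k ∈ K s)
    (s k : ℕ) : BddBelow (Set.range fun a : K s => φ.eval K (updateVar v s k a)) := by
  obtain ⟨B, -, hB⟩ := φ.exists_abs_eval_le hK
  refine ⟨-B, ?_⟩
  rintro _ ⟨a, rfl⟩
  exact (abs_le.mp (hB _ (updateVar_mem hv k a.2))).1

/-- Formulas are uniformly continuous. -/
theorem SortedFormula.abs_eval_sub_le {G : Type u} [Group G] [MetricSpace G] {K : ℕ → Set G}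
    (hK : IsPresentation K) (φ : SortedFormula) {ε : ℝ} (hε : 0 < ε) :
    ∃ δ > 0, ∀ v w : ℕ → ℕ → G, (∀ s k, v s k ∈ K s) → (∀ s k, w s k ∈ K s) →
      (∀ s k, Dist.dist (v s k) (w s k) < δ) → |φ.eval K v - φ.eval K w| ≤ ε := by
  induction φ generalizing ε with
  | const q => exact ⟨1, one_pos, fun _ _ _ _ _ => by simpa [SortedFormula.eval] using hε.le⟩
  | dist t u =>
    obtain ⟨δ₁, hδ₁, h₁⟩ := t.eval_dist_lt hK (half_pos hε)
    obtain ⟨δ₂, hδ₂, h₂⟩ := u.eval_dist_lt hK (half_pos hε)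
    refine ⟨Min.min δ₁ δ₂, lt_min hδ₁ hδ₂, fun v w hv hw hvw => ?_⟩
    have e₁ := h₁ v w hv hw fun s k => (hvw s k).trans_le (min_le_left _ _)
    have e₂ := h₂ v w hv hw fun s k => (hvw s k).trans_le (min_le_right _ _)
    have := dist_dist_dist_le (t.eval v) (u.eval v) (t.eval w) (u.eval w)
    rw [Real.dist_eq] at this
    simp only [SortedFormula.eval]
    linarith
  | half φ ih | compl φ ih =>
    obtain ⟨δ, hδ, h⟩ := ih hε
    refine ⟨δ, hδ, fun v w hv hw hvw => ?_⟩
    have := abs_le.mp (h v w hv hw hvw)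
    simp only [SortedFormula.eval]
    rw [abs_le]
    constructor <;> linarith
  | tsub φ ψ ihφ ihψ | min φ ψ ihφ ihψ | max φ ψ ihφ ihψ | absSub φ ψ ihφ ihψ | add φ ψ ihφ ihψ =>
    obtain ⟨δ₁, hδ₁, h₁⟩ := ihφ (half_pos hε)
    obtain ⟨δ₂, hδ₂, h₂⟩ := ihψ (half_pos hε)
    refine ⟨Min.min δ₁ δ₂, lt_min hδ₁ hδ₂, fun v w hv hw hvw => ?_⟩
    have e₁ := abs_le.mp (h₁ v w hv hw fun s k => (hvw s k).trans_le (min_le_left _ _))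
    have e₂ := abs_le.mp (h₂ v w hv hw fun s k => (hvw s k).trans_le (min_le_right _ _))
    simp only [SortedFormula.eval]
    grind
  | sup s k φ ih =>
    obtain ⟨δ, hδ, h⟩ := ih hε
    have key : ∀ v w : ℕ → ℕ → G, (∀ s k, v s k ∈ K s) → (∀ s k, w s k ∈ K s) →
        (∀ s k, Dist.dist (v s k) (w s k) < δ) →
        (SortedFormula.sup s k φ).eval K v ≤ (SortedFormula.sup s k φ).eval K w + ε := by
      intro v w hv hw hvw
      have : Nonempty (K s) := ⟨⟨1, hK.one_mem s⟩⟩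
      simp only [SortedFormula.eval]
      refine ciSup_le fun a => ?_
      have h1 := abs_le.mp (h _ _ (updateVar_mem hv k a.2) (updateVar_mem hw k a.2)
        (updateVar_dist_lt hδ hvw s k a))
      have h2 := le_ciSup (φ.bddAbove_range_eval hK hw s k) a
      linarith
    refine ⟨δ, hδ, fun v w hv hw hvw => abs_le.mpr ⟨?_, ?_⟩⟩
    · have := key w v hw hv fun s k => by rw [dist_comm]; exact hvw s k
      linarith
    · have := key v w hv hw hvw
      linarith
  | inf s k φ ih =>
    obtain ⟨δ, hδ, h⟩ := ih hε
    have key : ∀ v w : ℕ → ℕ → G, (∀ s k, v s k ∈ K s) → (∀ s k, w s k ∈ K s) →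
        (∀ s k, Dist.dist (v s k) (w s k) < δ) →
        (SortedFormula.inf s k φ).eval K v - ε ≤ (SortedFormula.inf s k φ).eval K w := by
      intro v w hv hw hvw
      have : Nonempty (K s) := ⟨⟨1, hK.one_mem s⟩⟩
      simp only [SortedFormula.eval]
      refine le_ciInf fun a => ?_
      have h1 := abs_le.mp (h _ _ (updateVar_mem hv k a.2) (updateVar_mem hw k a.2)
        (updateVar_dist_lt hδ hvw s k a))
      have h2 := ciInf_le (φ.bddBelow_range_eval hK hv s k) a
      linarith
    refine ⟨δ, hδ, fun v w hv hw hvw => abs_le.mpr ⟨?_, ?_⟩⟩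
    · have := key w v hw hv fun s k => by rw [dist_comm]; exact hvw s k
      linarith
    · have := key v w hv hw hvw
      linarith

/-! ### Elementary closed subgroups -/

/-- The assignment coded by a finite list; it respects the sorts. -/
noncomputable def listAssignment {G : Type u} [Group G] (K : ℕ → Set G) (l : List G) : ℕ → ℕ → G :=
  open Classical in
  -- Missing or ill-sorted entries become `1`, so that formulas are bounded along every list.
  fun s k => if l.getD (Nat.pair s k) 1 ∈ K s then l.getD (Nat.pair s k) 1 else 1

theorem listAssignment_mem {G : Type u} [Group G] {K : ℕ → Set G} (h1 : ∀ n, (1 : G) ∈ K n)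
    (l : List G) (s k : ℕ) : listAssignment K l s k ∈ K s := by
  unfold listAssignment
  split_ifs with h
  exacts [h, h1 s]

theorem exists_listAssignment_eq {G : Type u} [Group G] {K : ℕ → Set G} {H : Subgroup G}
    {v : ℕ → ℕ → G} (hv : ∀ s k, v s k ∈ K s) (hvH : ∀ s k, v s k ∈ H) (M : ℕ) :
    ∃ l : List G, (∀ x ∈ l, x ∈ H) ∧
      ∀ s k, Nat.pair s k < M → listAssignment K l s k = v s k := by
  refine ⟨(List.range M).map fun p => v p.unpair.1 p.unpair.2, ?_, fun s k hk => ?_⟩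
  · intro x hx
    obtain ⟨p, -, rfl⟩ := List.mem_map.mp hx
    exact hvH _ _
  · have : ((List.range M).map fun p => v p.unpair.1 p.unpair.2).getD (Nat.pair s k) 1 =
        v s k := by
      simp [List.getD_eq_getElem?_getD, List.getElem?_map, List.getElem?_range hk]
    unfold listAssignment
    rw [this, if_pos (hv s k)]

/-- The Tarski–Vaught test for the closure of a subgroup `H`, with approximate witnesses for
suprema over the sorts and approximate nearest points of the sorts. -/
theorem isElementarySubgroup_topologicalClosure {G : Type u} [Group G] [MetricSpace G]
    [IsTopologicalGroup G] {K : ℕ → Set G} (hK : IsPresentation K) {H : Subgroup G}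
    (hdist : ∀ y ∈ H, ∀ (n : ℕ) (ε : ℝ), 0 < ε →
      ∃ b ∈ H, b ∈ K n ∧ ∀ a ∈ K n, dist y b ≤ dist y a + ε)
    (hsup : ∀ (φ : SortedFormula) (s k : ℕ) (v : ℕ → ℕ → G), (∀ s k, v s k ∈ K s) →
      (∀ s k, v s k ∈ H) → ∀ ε : ℝ, 0 < ε → ∃ b ∈ H, b ∈ K s ∧ ∀ a ∈ K s,
        φ.eval K (updateVar v s k a) ≤ φ.eval K (updateVar v s k b) + ε) :
    IsElementarySubgroup K H.topologicalClosure := by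
  have happrox : ∀ x ∈ H.topologicalClosure, ∀ n, x ∈ K n → ∀ ε : ℝ, 0 < ε →
      ∃ b ∈ H, b ∈ K n ∧ dist x b < ε := by
    intro x hx n hxn ε hε
    -- The nearby point `y` need not lie in `K n`. An almost nearest point `b` of `K n` to `y` is
    -- almost as close to `y` as `x` is.
    obtain ⟨y, hy, hxy⟩ := Metric.mem_closure_iff.mp hx (ε / 3) (by positivity)
    obtain ⟨b, hbH, hbK, hb⟩ := hdist y hy n (ε / 3) (by positivity)
    refine ⟨b, hbH, hbK, ?_⟩
    have h1 := hb x hxn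
    rw [dist_comm y x] at h1
    linarith [dist_triangle x y b]
  have hwit : ∀ (φ : SortedFormula) (s k : ℕ) (v : ℕ → ℕ → G), (∀ s k, v s k ∈ K s) →
      (∀ s k, v s k ∈ H.topologicalClosure) → ∀ a ∈ K s, ∀ ε : ℝ, 0 < ε →
        ∃ b ∈ H.topologicalClosure, b ∈ K s ∧
          φ.eval K (updateVar v s k a) ≤ φ.eval K (updateVar v s k b) + ε := by
    intro φ s k v hv hvH a ha ε hε
    -- The parameters are moved into `H`, a witness is found there, and the original parameters are
    -- restored; each of the three steps costs `ε / 3`.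
    obtain ⟨δ, hδ, hφ⟩ := φ.abs_eval_sub_le hK (ε := ε / 3) (by positivity)
    choose w hwH hwK hw using fun s k => happrox _ (hvH s k) s (hv s k) δ hδ
    obtain ⟨b, hbH, hbK, hb⟩ := hsup φ s k w hwK hwH (ε / 3) (by positivity)
    refine ⟨b, H.le_topologicalClosure hbH, hbK, ?_⟩
    have h1 := abs_le.mp (hφ _ _ (updateVar_mem hv k ha) (updateVar_mem hwK k ha)
      (updateVar_dist_lt hδ hw s k a))
    have h2 := abs_le.mp (hφ _ _ (updateVar_mem hv k hbK) (updateVar_mem hwK k hbK)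
      (updateVar_dist_lt hδ hw s k b))
    linarith [hb a ha]
  have hterm : ∀ {s : ℕ} (t : SortedTerm s) (v : ℕ → ℕ → H.topologicalClosure),
      ((t.eval v : H.topologicalClosure) : G) = t.eval fun s k => (v s k : G) := by
    intro s t v
    induction t with
    | var s k => rfl
    | one s => rfl
    | mul t u iht ihu => simp only [SortedTerm.eval, Subgroup.coe_mul, iht, ihu]
    | inv t ih => simp only [SortedTerm.eval, Subgroup.coe_inv, ih]
  have hupd : ∀ (v : ℕ → ℕ → H.topologicalClosure) (s k : ℕ) (a : H.topologicalClosure),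
      (fun s' k' => ((updateVar v s k a s' k' : H.topologicalClosure) : G)) =
        updateVar (fun s k => (v s k : G)) s k a := by
    intro v s k a
    funext s' k'
    simp only [updateVar]
    split_ifs <;> rfl
  intro φ
  induction φ with
  | const q => exact fun _ _ => rfl
  | dist t u =>
    intro v hv
    simp only [SortedFormula.eval, Subtype.dist_eq, hterm]
  | half φ ih | compl φ ih =>
    intro v hv
    simp only [SortedFormula.eval, ih v hv]
  | tsub φ ψ ihφ ihψ | min φ ψ ihφ ihψ | max φ ψ ihφ ihψ | absSub φ ψ ihφ ihψ | add φ ψ ihφ ihψ =>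
    intro v hv
    simp only [SortedFormula.eval, ihφ v hv, ihψ v hv]
  | sup s k φ ih =>
    intro v hv
    have hev : ∀ a : restrictChain K H.topologicalClosure s,
        φ.eval (restrictChain K H.topologicalClosure) (updateVar v s k a) =
          φ.eval K (updateVar (fun s k => (v s k : G)) s k ((a : H.topologicalClosure) : G)) := by
      intro a
      rw [ih _ (updateVar_mem hv k a.2), hupd]
    have hbdd := φ.bddAbove_range_eval hK (v := fun s k => (v s k : G)) hv s k
    have : Nonempty (K s) := ⟨⟨1, hK.one_mem s⟩⟩
    have : Nonempty (restrictChain K H.topologicalClosure s) := ⟨⟨1, hK.one_mem s⟩⟩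
    simp only [SortedFormula.eval, hev]
    refine le_antisymm (ciSup_le fun a => le_ciSup hbdd ⟨_, a.2⟩) (ciSup_le fun a => ?_)
    refine le_of_forall_pos_le_add fun ε hε => ?_
    obtain ⟨b, hbH, hbK, hb⟩ := hwit φ s k (fun s k => (v s k : G)) hv
      (fun s k => (v s k).2) a a.2 ε hε
    refine hb.trans (add_le_add_left ?_ ε)
    refine le_ciSup (f := fun a : restrictChain K H.topologicalClosure s => φ.eval K
      (updateVar (fun s k => (v s k : G)) s k ((a : H.topologicalClosure) : G))) ?_
      ⟨⟨b, hbH⟩, hbK⟩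
    refine hbdd.mono ?_
    rintro _ ⟨c, rfl⟩
    exact ⟨⟨_, c.2⟩, rfl⟩
  | inf s k φ ih =>
    intro v hv
    have hev : ∀ a : restrictChain K H.topologicalClosure s,
        φ.eval (restrictChain K H.topologicalClosure) (updateVar v s k a) =
          φ.eval K (updateVar (fun s k => (v s k : G)) s k ((a : H.topologicalClosure) : G)) := by
      intro a
      rw [ih _ (updateVar_mem hv k a.2), hupd]
    have hbdd := φ.bddBelow_range_eval hK (v := fun s k => (v s k : G)) hv s k
    have : Nonempty (K s) := ⟨⟨1, hK.one_mem s⟩⟩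
    have : Nonempty (restrictChain K H.topologicalClosure s) := ⟨⟨1, hK.one_mem s⟩⟩
    simp only [SortedFormula.eval, hev]
    refine le_antisymm (le_ciInf fun a => ?_) (le_ciInf fun a => ciInf_le hbdd ⟨_, a.2⟩)
    refine le_of_forall_pos_le_add fun ε hε => ?_
    -- Approximate minimizers of `φ` are approximate maximizers of `1 - φ`.
    obtain ⟨b, hbH, hbK, hb⟩ := hwit φ.compl s k (fun s k => (v s k : G)) hv
      (fun s k => (v s k).2) a a.2 ε hε
    simp only [SortedFormula.eval] at hb
    refine le_trans (b := φ.eval K (updateVar (fun s k => (v s k : G)) s k b)) ?_ (by linarith)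
    refine ciInf_le (f := fun a : restrictChain K H.topologicalClosure s => φ.eval K
      (updateVar (fun s k => (v s k : G)) s k ((a : H.topologicalClosure) : G))) ?_
      ⟨⟨b, hbH⟩, hbK⟩
    refine hbdd.mono ?_
    rintro _ ⟨c, rfl⟩
    exact ⟨⟨_, c.2⟩, rfl⟩

/-- The downward Löwenheim–Skolem theorem: every set `S` is contained in a subgroup of cardinality
at most `max #S ℵ₀` whose closure is elementary. -/
theorem exists_subgroup_isElementarySubgroup_topologicalClosure {G : Type u} [Group G]
    [MetricSpace G] [IsTopologicalGroup G] {K : ℕ → Set G} (hK : IsPresentation K) (S : Set G) :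
    ∃ H : Subgroup G, S ⊆ H ∧ #H ≤ max #S ℵ₀ ∧ IsElementarySubgroup K H.topologicalClosure := by
  obtain ⟨H, hSH, hcard, hH⟩ := exists_subgroup_approx_maximizers K (fun n => ⟨1, hK.one_mem n⟩)
    -- The index `none` yields approximate nearest points to `l.prod`, the others witnesses for
    -- suprema whose parameters are coded by `l`.
    (fun (i : Option (SortedFormula × ℕ × ℕ)) (l : List G) (a : G) => match i with
      | none => -dist l.prod a
      | some (φ, s, k) => φ.eval K (updateVar (listAssignment K l) s k a)) S
  refine ⟨H, hSH, hcard, isElementarySubgroup_topologicalClosure hK ?_ ?_⟩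
  · intro y hy n ε hε
    obtain ⟨b, hbH, hbK, hb⟩ := hH none [y] n ε hε (by simpa using hy)
      ⟨0, by rintro _ ⟨a, -, rfl⟩; simp⟩
    refine ⟨b, hbH, hbK, fun a ha => ?_⟩
    have := hb a ha
    simp only [List.prod_singleton] at this
    linarith
  · intro φ s k v hv hvH ε hε
    -- Only finitely many variables matter, so a finite list codes the parameters.
    obtain ⟨M, hM⟩ := φ.exists_eval_congr K
    obtain ⟨l, hlH, hl⟩ := exists_listAssignment_eq hv hvH M
    have hcongr : ∀ a, φ.eval K (updateVar v s k a) =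
        φ.eval K (updateVar (listAssignment K l) s k a) := fun a =>
      hM _ _ (updateVar_congr (fun s k hk => (hl s k hk).symm) s k a)
    obtain ⟨b, hbH, hbK, hb⟩ := hH (some (φ, s, k)) l s ε hε hlH (by
      obtain ⟨B, hB⟩ := φ.bddAbove_range_eval hK (listAssignment_mem hK.one_mem l) s k
      refine ⟨B, ?_⟩
      rintro _ ⟨a, ha, rfl⟩
      exact hB ⟨⟨a, ha⟩, rfl⟩)
    refine ⟨b, hbH, hbK, fun a ha => ?_⟩
    rw [hcongr, hcongr]
    exact hb a ha

theorem mainTheorem5 {G : Type u} [Group G] [MetricSpace G] [IsTopologicalGroup G]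
    (K : ℕ → Set G) (hK : IsPresentation K)
    (hball : ∀ i, ∃ r : ℝ, K i = Metric.closedBall (1 : G) r)
    (F : ℕ → ℝ → ℝ) (hF : IsModulusFamily F)
    (hKazhdan : ∀ i, ¬ IsModulusKazhdanSet K F (K i))
    (C : Set G) (hC : C.Infinite) :
    ∃ H : Subgroup G, C ⊆ (H : Set G) ∧ IsClosed (H : Set G) ∧
      IsElementarySubgroup K H ∧
      densityChar H = densityChar C ∧
      ¬ HasModulusPropertyT (restrictChain K H) F := by
  have : Infinite C := hC.to_subtype
  choose g hg using fun i m : ℕ => exists_forall_subgroup_not_kazhdan hK (hKazhdan i)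
    (Nat.one_div_pos_of_nat (α := ℝ) (n := m))
  obtain ⟨D, hD, hDcard⟩ := exists_dense_card_eq_densityChar C
  obtain ⟨H, hSH, hcard, hel⟩ := exists_subgroup_isElementarySubgroup_topologicalClosure hK
    (Subtype.val '' D ∪ Set.range fun p : ℕ × ℕ => g p.1 p.2)
  have hω := aleph0_le_densityChar C
  have hCH : C ⊆ (H.topologicalClosure : Set G) := by
    intro x hx
    have h1 : x ∈ closure (Subtype.val '' D) :=
      image_closure_subset_closure_image continuous_subtype_val ⟨⟨x, hx⟩, hD _, rfl⟩
    exact closure_mono (Set.subset_union_left.trans hSH) h1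
  refine ⟨H.topologicalClosure, hCH, H.isClosed_topologicalClosure, hel, le_antisymm ?_ ?_, ?_⟩
  · have hdense : Dense ((↑) ⁻¹' (H : Set G) : Set H.topologicalClosure) := by
      rw [Subtype.dense_iff]
      intro x hx
      refine closure_mono (s := (H : Set G)) ?_ hx
      exact fun y hy => ⟨⟨y, H.le_topologicalClosure hy⟩, hy, rfl⟩
    refine (densityChar_le hdense).trans ((Cardinal.mk_preimage_of_injective _ _
      Subtype.val_injective).trans (hcard.trans (max_le ?_ hω)))
    refine (Cardinal.mk_union_le _ _).trans ((add_le_add ?_ ?_).trans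
      (Cardinal.add_eq_self hω).le)
    · exact Cardinal.mk_image_le.trans hDcard.le
    · exact (Cardinal.mk_le_aleph0_iff.mpr (Set.countable_range _)).trans hω
  · exact densityChar_le_of_isometry (f := Set.inclusion hCH) fun _ _ => rfl
  · rintro ⟨Q, hQ, -, ε, hε, hT⟩
    obtain ⟨i, hi⟩ := exists_subset_restrictChain_of_isCompact hK hball _ hQ
    -- The element `g i m` lies in the subgroup and refutes the Kazhdan constant `1 / (m + 1)`,
    -- hence also the larger `ε`.
    obtain ⟨m, hm⟩ := exists_nat_one_div_lt hε
    obtain ⟨E, _, _, _, π, hπ, ⟨v, hv, hlt⟩, hno⟩ := hg i m H.topologicalClosure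
      (H.le_topologicalClosure (hSH (Or.inr ⟨(i, m), rfl⟩))) Q hi
    exact hno (hT E π hπ ⟨v, hv, hlt.trans hm⟩)
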